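/- Let $\mathbb H$ be the quaternions and let $V$ be a bilateral quaternionic Banach space: a complete normed group with commuting left and right $\mathbb H$-multiplications that agree on $\mathbb R$ and satisfy $\|qv\|\le|q|\|v\|$, $\|vq\|\le|q|\|v\|$. Let $\mathcal B(V)$ be the space of bounded right linear operators on $V$ with the operator norm, let $\mathcal I$ be the identity, and put $(qT)(v)=q\,T(v)$, $(Tq)(v)=T(qv)$ for $T\in\mathcal B(V)$, $q\in\mathbb H$. For $T\in\mathcal B(V)$ let $$\sigma_S(T)=\{s\in\mathbb H:\ T^2-2\,\mathrm{Re}[s]\,T+|s|^2\mathcal I\ \text{ is not invertible in }\mathcal B(V)\},$$ and for $s\notin\sigma_S(T)$ let $$S^{-1}(s,T)=-(T^2-2\,\mathrm{Re}[s]\,T+|s|^2\mathcal I)^{-1}(T-\overline s\,\mathcal I).$$ Let $I\in\mathbb H$ satisfy $\mathrm{Re}[I]=0$ and $|I|=1$, and let $L_I=\mathbb R+I\mathbb R$, identified with $\mathbb C$ by $x+Iy\leftrightarrow x+iy$. Let $U\subset L_I$ be bounded, open in $L_I$, with $L_I\cap\sigma_S(T)\subset U$, and suppose that its boundary $\partial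 U$ in $L_I$ is positively oriented by finitely many closed rectifiable curves $\gamma_1,\dots,\gamma_n$ in $L_I$, parametrized on $[0,1]$ by Lipschitz maps. That is, the union of their images is $\partial U$, and the sum of their winding numbers is $1$ about each point of $U$ and $0$ about each point of $L_I\setminus\overline U$. For $f:\mathbb H\to\mathbb H$ write $$\int_{\partial U}S^{-1}(s,T)\,ds_I\,f(s)=\sum_{k=1}^n\int_0^1 S^{-1}(\gamma_k(t),T)\,\bigl(-I\,\gamma_k'(t)\bigr)\,f(\gamma_k(t))\,dt ,\qquad ds_I=-I\,ds,$$ with integrals taken in $\mathcal B(V)$. Then for every $m\in\mathbb N\cup\{0\}$ and $a\in\mathbb H$ the integrands for $f(s)=s^ma$ are integrable and $$T^m a=\frac1{2\pi}\int_{\partial U}S^{-1}(s,T)\,ds_I\,s^m\,a .$$ Consequently the $S$-functional calculus agrees with polynomial evaluation: for all $N\ge0$ and $a_0,\dots,a_N\in\mathbb H$ the integrands for $f(s)=\sum_{m=0}^N s^ma_m$ are integrable and $$\sum_{m=0}^N T^m a_m=\frac1{2\pi}\int_{\partial U}S^{-1}(s,T)\,ds_I\,\sum_{m=0}^N s^m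 a_m .$$ -/

import Mathlib

open scoped Quaternion

noncomputable section

namespace QuatFC

section Operators

/- `V` is a bilateral quaternionic Banach space: a complete normed group with commuting left and
right multiplications by quaternions, each bounded by the modulus of the quaternion.  The right
multiplication `v q` is the action of `MulOpposite.op q`, in the ring `ℍ[ℝ]ᵐᵒᵖ`.  Both actions
restrict to the same real vector space structure. -/
variable {V : Type*} [NormedAddCommGroup V] [NormedSpace ℝ V]
  [Module ℍ[ℝ]ᵐᵒᵖ V] [IsScalarTower ℝ ℍ[ℝ]ᵐᵒᵖ V]

/-- The operator norm on the bounded right linear operators `B(V) = (V →L[ℍ[ℝ]ᵐᵒᵖ] V)`. -/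
instance instNormedAddCommGroupB : NormedAddCommGroup (V →L[ℍ[ℝ]ᵐᵒᵖ] V) :=
  NormedAddCommGroup.induced (V →L[ℍ[ℝ]ᵐᵒᵖ] V) (V →L[ℝ] V)
    ({ toFun := fun T => T.restrictScalars ℝ
       map_zero' := rfl
       map_add' := fun _ _ => rfl } : (V →L[ℍ[ℝ]ᵐᵒᵖ] V) →+ (V →L[ℝ] V))
    (fun A B h => by
      ext v
      exact DFunLike.congr_fun h v)

theorem norm_restrictScalars (T : V →L[ℍ[ℝ]ᵐᵒᵖ] V) :
    ‖T.restrictScalars ℝ‖ = ‖T‖ := rfl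

instance instNormedSpaceB : NormedSpace ℝ (V →L[ℍ[ℝ]ᵐᵒᵖ] V) where
  norm_smul_le c T := by
    rw [← norm_restrictScalars, ← norm_restrictScalars]
    exact norm_smul_le c (T.restrictScalars ℝ)

/-- `B(V)` is a Banach space, so the Bochner integrals below are the genuine ones. -/
instance instCompleteSpaceB [CompleteSpace V] [IsBoundedSMul ℍ[ℝ]ᵐᵒᵖ V] :
    CompleteSpace (V →L[ℍ[ℝ]ᵐᵒᵖ] V) := by
  let φ : (V →L[ℍ[ℝ]ᵐᵒᵖ] V) → (V →L[ℝ] V) := fun T => T.restrictScalars ℝ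
  have hφ : Isometry φ := Isometry.of_dist_eq fun A B => by
    rw [dist_eq_norm, dist_eq_norm]
    rfl
  have hr : Set.range φ = ⋂ (q : ℍ[ℝ]ᵐᵒᵖ) (v : V), {A : V →L[ℝ] V | A (q • v) = q • A v} := by
    ext A
    simp only [Set.mem_range, Set.mem_iInter, Set.mem_ofPred_eq]
    constructor
    · rintro ⟨T, rfl⟩ q v
      exact T.map_smul q v
    · intro h
      exact ⟨{ toFun := A, map_add' := A.map_add, map_smul' := h, cont := A.cont }, rfl⟩
  refine (completeSpace_iff_isComplete_range hφ.isUniformInducing).2 (IsClosed.isComplete ?_)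
  rw [hr]
  refine isClosed_iInter fun q => isClosed_iInter fun v => isClosed_eq ?_ ?_
  · exact (ContinuousLinearMap.apply ℝ V (q • v)).continuous
  · exact (ContinuousLinearMap.apply ℝ V v).continuous.const_smul q

variable [Module ℍ[ℝ] V] [SMulCommClass ℍ[ℝ]ᵐᵒᵖ ℍ[ℝ] V] [IsScalarTower ℝ ℍ[ℝ] V]
  [IsBoundedSMul ℍ[ℝ] V]

/-- The operator `aℐ : v ↦ a v` of left multiplication by `a`.  In terms of it the left and right
multiplications of an operator by a quaternion, `(aT)(v) = a T(v)` and `(Ta)(v) = T(a v)`, are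
`leftMul a * T` and `T * leftMul a`, where `*` is composition. -/
def leftMul (a : ℍ[ℝ]) : V →L[ℍ[ℝ]ᵐᵒᵖ] V := a • (1 : V →L[ℍ[ℝ]ᵐᵒᵖ] V)

/-- The operator `T² - 2 Re[s] T + |s|² ℐ`. -/
def sPoly (s : ℍ[ℝ]) (T : V →L[ℍ[ℝ]ᵐᵒᵖ] V) : V →L[ℍ[ℝ]ᵐᵒᵖ] V :=
  T ^ 2 - (2 * s.re) • T + (‖s‖ ^ 2) • (1 : V →L[ℍ[ℝ]ᵐᵒᵖ] V)

/-- The `S`-spectrum: the quaternions `s` for which `T² - 2 Re[s] T + |s|² ℐ` has no two-sided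
inverse in `B(V)`. -/
def sSpectrum (T : V →L[ℍ[ℝ]ᵐᵒᵖ] V) : Set ℍ[ℝ] := {s | ¬ IsUnit (sPoly s T)}

/-- The `S`-resolvent operator `S⁻¹(s,T) = -(T² - 2 Re[s] T + |s|² ℐ)⁻¹ (T - s̄ ℐ)`, meant for `s`
outside the `S`-spectrum. -/
def sResolvent (s : ℍ[ℝ]) (T : V →L[ℍ[ℝ]ᵐᵒᵖ] V) : V →L[ℍ[ℝ]ᵐᵒᵖ] V :=
  -(Ring.inverse (sPoly s T) * (T - leftMul (star s)))

end Operators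

/-- The sphere `𝕊` of purely imaginary unit quaternions. -/
def unitSphere : Set ℍ[ℝ] := {q | q.re = 0 ∧ ‖q‖ = 1}

/-- The map `x + i y ↦ x + I y`; for `I ∈ 𝕊` it is an isometric isomorphism of `ℂ` onto the
plane `L_I`. -/
def slice (I : ℍ[ℝ]) (z : ℂ) : ℍ[ℝ] := (z.re : ℍ[ℝ]) + I * (z.im : ℍ[ℝ])

/-- The plane `L_I = ℝ + I ℝ`. -/
def slicePlane (I : ℍ[ℝ]) : Set ℍ[ℝ] := Set.range (slice I)

/-- The winding number about `z` of a closed rectifiable curve `γ : [0,1] → ℂ`. -/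
def windingNumber (γ : ℝ → ℂ) (z : ℂ) : ℂ :=
  (2 * Real.pi * Complex.I)⁻¹ * ∫ t in (0 : ℝ)..1, deriv γ t / (γ t - z)

/-- The closed rectifiable curves `γ 0, …, γ (n-1)`, parametrized on `[0,1]` by Lipschitz maps
(for instance piecewise `C¹` maps), form the positively oriented boundary of `D ⊆ ℂ`: together
they trace out `∂D`, they wind once around each point of `D`, and do not wind around the points
outside the closure of `D`. -/
structure IsPositiveBoundary (D : Set ℂ) {n : ℕ} (γ : Fin n → ℝ → ℂ) : Prop where
  lipschitz : ∀ k, ∃ K : NNReal, LipschitzOnWith K (γ k) (Set.Icc 0 1)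
  closed : ∀ k, γ k 0 = γ k 1
  trace : ⋃ k, γ k '' Set.Icc 0 1 = frontier D
  winding_inside : ∀ z ∈ D, ∑ k, windingNumber (γ k) z = 1
  winding_outside : ∀ z ∉ closure D, ∑ k, windingNumber (γ k) z = 0

section Integral

variable {V : Type*} [NormedAddCommGroup V] [NormedSpace ℝ V]
  [Module ℍ[ℝ] V] [Module ℍ[ℝ]ᵐᵒᵖ V] [SMulCommClass ℍ[ℝ]ᵐᵒᵖ ℍ[ℝ] V]
  [IsScalarTower ℝ ℍ[ℝ] V] [IsScalarTower ℝ ℍ[ℝ]ᵐᵒᵖ V]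
  [IsBoundedSMul ℍ[ℝ] V] [IsBoundedSMul ℍ[ℝ]ᵐᵒᵖ V]

/-- The integrand of `∫ S⁻¹(s,T) ds_I f(s)` along the curve `s = γ(t)` in `L_I ≅ ℂ`, where
`ds_I = -I ds = -I γ'(t) dt`. -/
def sIntegrand (I : ℍ[ℝ]) (T : V →L[ℍ[ℝ]ᵐᵒᵖ] V) (f : ℍ[ℝ] → ℍ[ℝ]) (γ : ℝ → ℂ) (t : ℝ) :
    V →L[ℍ[ℝ]ᵐᵒᵖ] V :=
  sResolvent (slice I (γ t)) T *
    leftMul (-I * slice I (deriv γ t) * f (slice I (γ t)))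

/-- The integral `∫ S⁻¹(s,T) ds_I f(s)` over the curves `γ 0, …, γ (n-1)` in `L_I ≅ ℂ`, a Bochner
integral in `B(V)` with its operator norm. -/
def sIntegral (I : ℍ[ℝ]) (T : V →L[ℍ[ℝ]ᵐᵒᵖ] V) (f : ℍ[ℝ] → ℍ[ℝ]) {n : ℕ}
    (γ : Fin n → ℝ → ℂ) : V →L[ℍ[ℝ]ᵐᵒᵖ] V :=
  ∑ k, ∫ t in (0 : ℝ)..1, sIntegrand I T f (γ k) t

end Integral

end QuatFC

end

/-!
Fix `I` and let a complex number act on `B(V)` by right multiplication with its image in `L_I`. This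
makes `B(V)` a complex Banach space on which the left multiplication `L_T : X ↦ T X` is complex
linear, and `(z̄ - L_T) (z - L_T)` is left multiplication by `T² - 2 Re[z] T + |z|² ℐ`. Hence the
spectrum of `L_T` lies in `L_I ∩ σ_S(T)`, the `S`-resolvent is the resolvent of `L_T` applied to
`ℐ`, and the theorem becomes the Riesz formula `∮ zᵐ (z - L_T)⁻¹ dz = 2πi L_Tᵐ` at `ℐ`.

The Riesz formula for an element `a` of a complex Banach algebra reduces to `m = 0`, because
`z (z - a)⁻¹ = 1 + a (z - a)⁻¹` and the integral of a power over a closed curve vanishes. For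
`m = 0`, let `Q` be the difference of the two sides. The resolvent identity and the winding number
hypothesis show that the Cauchy integral of the resolvent extends `(z - a)⁻¹ Q` holomorphically
across the spectrum, so that `Q = 0` by Liouville's theorem.
-/

noncomputable section

namespace QuatFC

open MeasureTheory Set Filter Topology NNReal Interval

section LipschitzPaths

variable {E : Type*} [NormedAddCommGroup E] [NormedSpace ℝ E] {f : ℝ → E} {K : ℝ≥0} {a b : ℝ}

theorem ae_uIcc_mem_nhds (a b : ℝ) : ∀ᵐ t : ℝ, t ∈ Ι a b → uIcc a b ∈ 𝓝 t := by
  filter_upwards [compl_mem_ae_iff.2 (measure_singleton (a ⊔ b))] with t hne ht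
  exact Icc_mem_nhds ht.1 (ht.2.lt_of_ne hne)

theorem ae_norm_deriv_le_of_lipschitzOnWith (hf : LipschitzOnWith K f [[a, b]]) :
    ∀ᵐ t : ℝ, t ∈ Ι a b → ‖deriv f t‖ ≤ K := by
  filter_upwards [ae_uIcc_mem_nhds a b] with t ht h
  exact norm_deriv_le_of_lipschitzOn (ht h) hf

theorem intervalIntegrable_deriv_of_lipschitzOnWith [CompleteSpace E]
    (hf : LipschitzOnWith K f [[a, b]]) : IntervalIntegrable (deriv f) volume a b := by
  refine (intervalIntegrable_const (c := (K : ℝ))).mono_fun (aestronglyMeasurable_deriv f _) ?_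
  rw [EventuallyLE, ae_restrict_iff' measurableSet_uIoc]
  simpa using ae_norm_deriv_le_of_lipschitzOnWith hf

theorem ae_differentiableAt_of_lipschitzOnWith [FiniteDimensional ℝ E]
    (hf : LipschitzOnWith K f [[a, b]]) : ∀ᵐ t : ℝ, t ∈ Ι a b → DifferentiableAt ℝ f t := by
  filter_upwards [hf.absolutelyContinuousOnInterval.boundedVariationOn
    |>.ae_differentiableAt_of_mem_uIcc] with t ht h
  exact ht (uIoc_subset_uIcc h)

theorem integral_deriv_eq_sub_of_lipschitzOnWith [CompleteSpace E]
    (hf : LipschitzOnWith K f [[a, b]])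
    (hd : ∀ᵐ t : ℝ, t ∈ Ι a b → DifferentiableAt ℝ f t) :
    ∫ t in a..b, deriv f t = f b - f a := by
  refine (SeparatingDual.eq_iff_forall_dual_eq (R := ℝ)).2 fun L => ?_
  have hL : LipschitzOnWith (‖L‖₊ * K) (L ∘ f) [[a, b]] := L.lipschitz.comp_lipschitzOnWith hf
  calc L (∫ t in a..b, deriv f t) = ∫ t in a..b, L (deriv f t) :=
        (L.intervalIntegral_comp_comm (intervalIntegrable_deriv_of_lipschitzOnWith hf)).symm
    _ = ∫ t in a..b, deriv (L ∘ f) t := by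
        refine intervalIntegral.integral_congr_ae (hd.mono fun t ht h => ?_)
        exact (L.hasFDerivAt.comp_hasDerivAt t (ht h).hasDerivAt).deriv.symm
    _ = L (f b - f a) := by
        rw [hL.absolutelyContinuousOnInterval.integral_deriv_eq_sub, map_sub]
        rfl

end LipschitzPaths

section ContourIntegral

variable {E F : Type*} [NormedAddCommGroup E] [NormedSpace ℂ E]

/-- The integral `∫ f(w) dw` of a function `f` along a path `γ : [0,1] → ℂ`. -/
def contourIntegral (γ : ℝ → ℂ) (f : ℂ → E) : E := ∫ t in (0 : ℝ)..1, deriv γ t • f (γ t)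

/-- Integrability of `f` along `γ`, the condition under which `contourIntegral γ f` is not a junk
value. -/
def ContourIntegrable (γ : ℝ → ℂ) (f : ℂ → E) : Prop :=
  IntervalIntegrable (fun t => deriv γ t • f (γ t)) volume 0 1

variable {γ : ℝ → ℂ} {K : ℝ≥0} {f g : ℂ → E}

theorem ContourIntegrable.of_continuousOn (hγ : LipschitzOnWith K γ (Icc 0 1))
    (hf : ContinuousOn f (γ '' Icc 0 1)) : ContourIntegrable γ f := by
  rw [← uIcc_of_le zero_le_one] at hγ hf
  exact (intervalIntegrable_deriv_of_lipschitzOnWith hγ).smul_continuousOn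
    (hf.comp hγ.continuousOn (mapsTo_image _ _))

theorem contourIntegral_congr (h : EqOn f g (γ '' Icc 0 1)) :
    contourIntegral γ f = contourIntegral γ g := by
  refine intervalIntegral.integral_congr fun t ht => ?_
  rw [uIcc_of_le zero_le_one] at ht
  exact congrArg (deriv γ t • ·) (h (mem_image_of_mem γ ht))

theorem ContourIntegrable.congr (hf : ContourIntegrable γ f) (h : EqOn f g (γ '' Icc 0 1)) :
    ContourIntegrable γ g := by
  refine IntervalIntegrable.congr (fun t ht => ?_) hf
  rw [uIoc_of_le zero_le_one] at ht
  exact congrArg (deriv γ t • ·) (h (mem_image_of_mem γ (Ioc_subset_Icc_self ht)))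

theorem contourIntegral_add (hf : ContourIntegrable γ f) (hg : ContourIntegrable γ g) :
    contourIntegral γ (fun w => f w + g w) = contourIntegral γ f + contourIntegral γ g := by
  simp_rw [contourIntegral, smul_add]
  exact intervalIntegral.integral_add hf hg

theorem contourIntegral_sub (hf : ContourIntegrable γ f) (hg : ContourIntegrable γ g) :
    contourIntegral γ (fun w => f w - g w) = contourIntegral γ f - contourIntegral γ g := by
  simp_rw [contourIntegral, smul_sub]
  exact intervalIntegral.integral_sub hf hg

theorem contourIntegral_smul_const [CompleteSpace E] (c : ℂ → ℂ) (v : E) :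
    contourIntegral γ (fun w => c w • v) = contourIntegral γ c • v := by
  simp_rw [contourIntegral, ← smul_assoc]
  exact intervalIntegral.integral_smul_const _ v

theorem ContourIntegrable.map [NormedAddCommGroup F] [NormedSpace ℂ F] (L : E →L[ℂ] F)
    (hf : ContourIntegrable γ f) : ContourIntegrable γ (fun w => L (f w)) := by
  simp_rw [ContourIntegrable, ← map_smul]
  exact ⟨L.integrable_comp hf.1, L.integrable_comp hf.2⟩

theorem map_contourIntegral [CompleteSpace E] [NormedAddCommGroup F] [NormedSpace ℂ F]
    [CompleteSpace F] (L : E →L[ℂ] F) (hf : ContourIntegrable γ f) :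
    L (contourIntegral γ f) = contourIntegral γ (fun w => L (f w)) := by
  simp_rw [contourIntegral, ← map_smul]
  exact (L.intervalIntegral_comp_comm hf).symm

theorem ContourIntegrable.map_addMonoidHom [NormedAddCommGroup F] [NormedSpace ℝ F] {φ : E →+ F}
    (hφ : Continuous φ) (hf : ContourIntegrable γ f) :
    IntervalIntegrable (fun t => φ (deriv γ t • f (γ t))) volume 0 1 :=
  ⟨(φ.toRealLinearMap hφ).integrable_comp hf.1, (φ.toRealLinearMap hφ).integrable_comp hf.2⟩

theorem map_contourIntegral_addMonoidHom [CompleteSpace E] [NormedAddCommGroup F] [NormedSpace ℝ F]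
    [CompleteSpace F] {φ : E →+ F} (hφ : Continuous φ) (hf : ContourIntegrable γ f) :
    φ (contourIntegral γ f) = ∫ t in (0 : ℝ)..1, φ (deriv γ t • f (γ t)) :=
  ((φ.toRealLinearMap hφ).intervalIntegral_comp_comm hf).symm

theorem contourIntegral_deriv_eq_zero [CompleteSpace E] (hγ : LipschitzOnWith K γ (Icc 0 1))
    (hclosed : γ 0 = γ 1) {U : Set ℂ} (hU : IsOpen U) (hγU : MapsTo γ (Icc 0 1) U)
    (hf : DifferentiableOn ℂ f U) : contourIntegral γ (deriv f) = 0 := by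
  have hloc : LocallyLipschitzOn (γ '' Icc 0 1) f := by
    rintro _ ⟨t, ht, rfl⟩
    obtain ⟨C, s, hs, hC⟩ := ((hf.contDiffOn hU).contDiffAt
      (hU.mem_nhds (hγU ht))).exists_lipschitzOnWith
    exact ⟨C, s, mem_nhdsWithin_of_mem_nhds hs, hC⟩
  obtain ⟨C, hC⟩ := hloc.exists_lipschitzOnWith_of_compact
    (isCompact_Icc.image_of_continuousOn hγ.continuousOn)
  have hfγ : LipschitzOnWith (C * K) (f ∘ γ) (Icc 0 1) := hC.comp hγ (mapsTo_image _ _)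
  rw [← uIcc_of_le zero_le_one] at hγ hγU hfγ
  have hderiv : ∀ᵐ t : ℝ, t ∈ Ι (0 : ℝ) 1 →
      HasDerivAt (f ∘ γ) (deriv γ t • deriv f (γ t)) t := by
    filter_upwards [ae_differentiableAt_of_lipschitzOnWith hγ] with t ht h
    exact (hf.differentiableAt (hU.mem_nhds (hγU (uIoc_subset_uIcc h)))).hasDerivAt.scomp t
      (ht h).hasDerivAt
  calc contourIntegral γ (deriv f) = ∫ t in (0 : ℝ)..1, deriv (f ∘ γ) t :=
        intervalIntegral.integral_congr_ae (hderiv.mono fun t ht h => (ht h).deriv.symm)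
    _ = (f ∘ γ) 1 - (f ∘ γ) 0 := integral_deriv_eq_sub_of_lipschitzOnWith hfγ
        (hderiv.mono fun t ht h => (ht h).differentiableAt)
    _ = 0 := by rw [Function.comp_apply, Function.comp_apply, hclosed, sub_self]

theorem contourIntegral_pow_eq_zero (hγ : LipschitzOnWith K γ (Icc 0 1)) (hclosed : γ 0 = γ 1)
    (m : ℕ) : contourIntegral γ (fun w => w ^ m) = 0 := by
  have hderiv : deriv (fun w : ℂ => w ^ (m + 1) / (m + 1)) = fun w => w ^ m := by
    ext w
    simp [Nat.cast_add_one_ne_zero]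
  rw [← hderiv]
  exact contourIntegral_deriv_eq_zero hγ hclosed isOpen_univ (mapsTo_univ _ _) (by fun_prop)

theorem contourIntegral_inv_sub_sq_eq_zero (hγ : LipschitzOnWith K γ (Icc 0 1))
    (hclosed : γ 0 = γ 1) {z : ℂ} (hz : z ∉ γ '' Icc 0 1) :
    contourIntegral γ (fun w => (w - z)⁻¹ ^ 2) = 0 := by
  have hderiv : ∀ w ≠ z, HasDerivAt (fun w => -(w - z)⁻¹) ((w - z)⁻¹ ^ 2) w := fun w hw => by
    simpa [neg_div] using (((hasDerivAt_id w).sub_const z).fun_inv (sub_ne_zero.2 hw)).fun_neg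
  have hγz : MapsTo γ (Icc 0 1) {z}ᶜ := fun t ht h => hz ⟨t, ht, h⟩
  rw [← contourIntegral_deriv_eq_zero hγ hclosed isOpen_compl_singleton hγz fun w hw =>
    (hderiv w hw).differentiableAt.differentiableWithinAt]
  exact contourIntegral_congr <| forall_mem_image.2 fun t ht => (hderiv _ (hγz ht)).deriv.symm

theorem exists_forall_ball_le_norm_sub {S : Set ℂ} (hS : IsClosed S) {z₀ : ℂ} (hz₀ : z₀ ∉ S) :
    ∃ r > 0, ∀ z ∈ Metric.ball z₀ r, ∀ w ∈ S, r ≤ ‖w - z‖ := by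
  obtain ⟨r, hr, hball⟩ := Metric.isOpen_iff.1 hS.isOpen_compl z₀ hz₀
  refine ⟨r / 2, half_pos hr, fun z hz w hw => ?_⟩
  by_contra! h
  refine hball ?_ hw
  rw [Metric.mem_ball] at hz ⊢
  rw [← dist_eq_norm] at h
  linarith [dist_triangle w z z₀]

theorem hasDerivAt_contourIntegral_inv_sub_smul (hγ : LipschitzOnWith K γ (Icc 0 1))
    (hf : ContinuousOn f (γ '' Icc 0 1)) {z₀ : ℂ} (hz₀ : z₀ ∉ γ '' Icc 0 1) :
    HasDerivAt (fun z => contourIntegral γ (fun w => (w - z)⁻¹ • f w))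
      (contourIntegral γ (fun w => (w - z₀)⁻¹ ^ 2 • f w)) z₀ := by
  have hcompact : IsCompact (γ '' Icc 0 1) := isCompact_Icc.image_of_continuousOn hγ.continuousOn
  obtain ⟨r, hr, hsep⟩ := exists_forall_ball_le_norm_sub hcompact.isClosed hz₀
  obtain ⟨M, hM⟩ := hcompact.exists_bound_of_continuousOn hf
  have hmem : ∀ t ∈ Ι (0 : ℝ) 1, γ t ∈ γ '' Icc 0 1 := fun t ht =>
    mem_image_of_mem γ (uIcc_of_le (zero_le_one' ℝ) ▸ uIoc_subset_uIcc ht)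
  have hne : ∀ z ∈ Metric.ball z₀ r, ∀ w ∈ γ '' Icc 0 1, w - z ≠ 0 := fun z hz w hw =>
    norm_pos_iff.1 (hr.trans_le (hsep z hz w hw))
  have hinv : ∀ z ∈ Metric.ball z₀ r, ContinuousOn (fun w => (w - z)⁻¹) (γ '' Icc 0 1) :=
    fun z hz => (continuousOn_id.sub continuousOn_const).inv₀ (hne z hz)
  have hz₀r : z₀ ∈ Metric.ball z₀ r := Metric.mem_ball_self hr
  refine (intervalIntegral.hasDerivAt_integral_of_dominated_loc_of_deriv_le (μ := volume)
    (F' := fun z t => deriv γ t • (γ t - z)⁻¹ ^ 2 • f (γ t)) (bound := fun _ => K * (r⁻¹ ^ 2 * M))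
    (Metric.ball_mem_nhds z₀ hr) ?_ ?_ ?_ ?_ ?_ ?_).2
  · filter_upwards [Metric.ball_mem_nhds z₀ hr] with z hz
    exact (ContourIntegrable.of_continuousOn hγ
      ((hinv z hz).smul hf)).aestronglyMeasurable_restrict_uIoc
  · exact ContourIntegrable.of_continuousOn hγ ((hinv z₀ hz₀r).smul hf)
  · exact (ContourIntegrable.of_continuousOn hγ
      (((hinv z₀ hz₀r).pow 2).smul hf)).aestronglyMeasurable_restrict_uIoc
  · rw [← uIcc_of_le zero_le_one] at hγ
    filter_upwards [ae_norm_deriv_le_of_lipschitzOnWith hγ] with t hderiv ht z hz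
    rw [norm_smul, norm_smul, norm_pow, norm_inv]
    gcongr
    exacts [hderiv ht, hsep z hz _ (hmem t ht), hM _ (hmem t ht)]
  · exact intervalIntegrable_const
  · refine .of_forall fun t ht z hz => ?_
    have h : HasDerivAt (fun z => (γ t - z)⁻¹) ((γ t - z)⁻¹ ^ 2) z := by
      simpa using ((hasDerivAt_id z).const_sub (γ t)).fun_inv (hne z hz _ (hmem t ht))
    exact (h.smul_const (f (γ t))).const_smul (deriv γ t)

end ContourIntegral

section WindingNumber

variable {γ : ℝ → ℂ} {K : ℝ≥0} {z : ℂ}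

theorem contourIntegral_inv_sub (γ : ℝ → ℂ) (z : ℂ) :
    contourIntegral γ (fun w => (w - z)⁻¹) = (2 * Real.pi * Complex.I) * windingNumber γ z :=
  (mul_inv_cancel_left₀ Complex.two_pi_I_ne_zero _).symm

theorem eventually_windingNumber_eq (hγ : LipschitzOnWith K γ (Icc 0 1)) (hclosed : γ 0 = γ 1)
    (hz : z ∉ γ '' Icc 0 1) : ∀ᶠ w in 𝓝 z, windingNumber γ w = windingNumber γ z := by
  have hcompact : IsCompact (γ '' Icc 0 1) := isCompact_Icc.image_of_continuousOn hγ.continuousOn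
  obtain ⟨r, hr, hball⟩ := Metric.isOpen_iff.1 hcompact.isClosed.isOpen_compl z hz
  have hderiv : ∀ w ∈ Metric.ball z r,
      HasDerivAt (fun w => contourIntegral γ (fun v => (v - w)⁻¹)) 0 w := fun w hw => by
    simpa only [smul_eq_mul, mul_one, contourIntegral_inv_sub_sq_eq_zero hγ hclosed (hball hw)]
      using hasDerivAt_contourIntegral_inv_sub_smul hγ (f := fun _ => (1 : ℂ))
        continuousOn_const (hball hw)
  filter_upwards [Metric.ball_mem_nhds z hr] with w hw
  refine mul_left_cancel₀ Complex.two_pi_I_ne_zero ?_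
  rw [← contourIntegral_inv_sub, ← contourIntegral_inv_sub]
  exact Metric.isOpen_ball.is_const_of_deriv_eq_zero (convex_ball z r).isPreconnected
    (fun v hv => (hderiv v hv).differentiableAt.differentiableWithinAt)
    (fun v hv => (hderiv v hv).deriv) hw (Metric.mem_ball_self hr)

/-- The cycle formed by the closed Lipschitz curves `γ k`, parametrized on `[0,1]`, avoids `S` and
winds exactly once around each point of `S`: the condition on a cycle in the Cauchy and Riesz
integral formulas. -/
structure WindsOnceAround (S : Set ℂ) {ι : Type*} [Fintype ι] (γ : ι → ℝ → ℂ) : Prop where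
  lipschitz : ∀ k, ∃ K : ℝ≥0, LipschitzOnWith K (γ k) (Icc 0 1)
  closed : ∀ k, γ k 0 = γ k 1
  mapsTo_compl : ∀ k, MapsTo (γ k) (Icc 0 1) Sᶜ
  winding : ∀ z ∈ S, ∑ k, windingNumber (γ k) z = 1

theorem IsPositiveBoundary.windsOnceAround {D S : Set ℂ} {n : ℕ} {γ : Fin n → ℝ → ℂ}
    (hγ : IsPositiveBoundary D γ) (hD : IsOpen D) (hS : S ⊆ D) : WindsOnceAround S γ where
  lipschitz := hγ.lipschitz
  closed := hγ.closed
  mapsTo_compl k t ht hmem := by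
    have hfrontier : γ k t ∈ frontier D :=
      hγ.trace ▸ mem_iUnion_of_mem k (mem_image_of_mem (γ k) ht)
    exact (hD.frontier_eq ▸ hfrontier).2 (hS hmem)
  winding z hz := hγ.winding_inside z (hS hz)

variable {ι : Type*} [Fintype ι] {S S' : Set ℂ} {γ : ι → ℝ → ℂ}

theorem WindsOnceAround.mono (hγ : WindsOnceAround S γ) (h : S' ⊆ S) : WindsOnceAround S' γ where
  lipschitz := hγ.lipschitz
  closed := hγ.closed
  mapsTo_compl k := (hγ.mapsTo_compl k).mono_right (compl_subset_compl.2 h)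
  winding z hz := hγ.winding z (h hz)

theorem WindsOnceAround.notMem_image (hγ : WindsOnceAround S γ) (hz : z ∈ S) (k : ι) :
    z ∉ γ k '' Icc 0 1 := by
  rintro ⟨t, ht, rfl⟩
  exact hγ.mapsTo_compl k ht hz

theorem WindsOnceAround.eventually_winding (hγ : WindsOnceAround S γ) (hz : z ∈ S) :
    ∀ᶠ w in 𝓝 z, ∑ k, windingNumber (γ k) w = 1 := by
  have hconst : ∀ k, ∀ᶠ w in 𝓝 z, windingNumber (γ k) w = windingNumber (γ k) z := fun k =>
    eventually_windingNumber_eq (hγ.lipschitz k).choose_spec (hγ.closed k) (hγ.notMem_image hz k)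
  filter_upwards [eventually_all.2 hconst] with w hw
  simp only [hw, hγ.winding z hz]

theorem WindsOnceAround.eventually_notMem_image (hγ : WindsOnceAround S γ) (hz : z ∈ S) :
    ∀ᶠ w in 𝓝 z, ∀ k, w ∉ γ k '' Icc 0 1 := by
  refine eventually_all.2 fun k => IsOpen.mem_nhds ?_ (hγ.notMem_image hz k)
  obtain ⟨K, hK⟩ := hγ.lipschitz k
  exact (isCompact_Icc.image_of_continuousOn hK.continuousOn).isClosed.isOpen_compl

end WindingNumber

section Riesz

variable {A : Type*} [NormedRing A] [NormedAlgebra ℂ A] {a : A} {z w : ℂ}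

theorem resolvent_sub_resolvent_eq_smul (hz : z ∈ resolventSet ℂ a) (hw : w ∈ resolventSet ℂ a) :
    resolvent a z - resolvent a w = (w - z) • (resolvent a z * resolvent a w) := by
  rw [resolvent, resolvent, Ring.inverse_sub_inverse (iff_of_true hz hw), sub_sub_sub_cancel_right,
    ← map_sub, Algebra.algebraMap_eq_smul_one (w - z), mul_smul_comm, mul_one, smul_mul_assoc]

theorem smul_resolvent_eq_one_add_mul (hz : z ∈ resolventSet ℂ a) :
    z • resolvent a z = 1 + a * resolvent a z := by
  have h : (algebraMap ℂ A z - a) * resolvent a z = 1 := Ring.mul_inverse_cancel _ hz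
  rw [← h, sub_mul, ← Algebra.smul_def, sub_add_cancel]

theorem WindsOnceAround.mapsTo_resolventSet {ι : Type*} [Fintype ι] {γ : ι → ℝ → ℂ}
    (hγ : WindsOnceAround (spectrum ℂ a) γ) (k : ι) :
    MapsTo (γ k) (Icc 0 1) (resolventSet ℂ a) := fun _ ht => not_not.1 (hγ.mapsTo_compl k ht)

variable [CompleteSpace A]

theorem continuousOn_resolvent (a : A) : ContinuousOn (resolvent a) (resolventSet ℂ a) :=
  fun _ hz => (spectrum.hasDerivAt_resolvent_const_left hz).continuousAt.continuousWithinAt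

variable {γ : ℝ → ℂ} {K : ℝ≥0}

theorem contourIntegrable_pow_smul_resolvent (hγ : LipschitzOnWith K γ (Icc 0 1))
    (hγa : MapsTo γ (Icc 0 1) (resolventSet ℂ a)) (m : ℕ) :
    ContourIntegrable γ (fun w => w ^ m • resolvent a w) :=
  .of_continuousOn hγ ((continuousOn_pow m).smul ((continuousOn_resolvent a).mono hγa.image_subset))

theorem contourIntegral_pow_smul_resolvent (hγ : LipschitzOnWith K γ (Icc 0 1))
    (hclosed : γ 0 = γ 1) (hγa : MapsTo γ (Icc 0 1) (resolventSet ℂ a)) (m : ℕ) :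
    contourIntegral γ (fun w => w ^ m • resolvent a w) =
      a ^ m * contourIntegral γ (resolvent a) := by
  induction m with
  | zero => simp only [pow_zero, one_smul, one_mul]
  | succ m ih =>
    have hint := contourIntegrable_pow_smul_resolvent hγ hγa m
    have hrec : EqOn (fun w => w ^ (m + 1) • resolvent a w)
        (fun w => w ^ m • (1 : A) + ContinuousLinearMap.mul ℂ A a (w ^ m • resolvent a w))
        (γ '' Icc 0 1) := forall_mem_image.2 fun t ht => by
      simp only [pow_succ, mul_smul, smul_resolvent_eq_one_add_mul (hγa ht), smul_add,
        ContinuousLinearMap.mul_apply', mul_smul_comm]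
    rw [contourIntegral_congr hrec, contourIntegral_add (.of_continuousOn hγ (by fun_prop))
        (hint.map _), contourIntegral_smul_const, contourIntegral_pow_eq_zero hγ hclosed, zero_smul,
      zero_add, ← map_contourIntegral _ hint, ih, ContinuousLinearMap.mul_apply', pow_succ',
      mul_assoc]

theorem contourIntegral_inv_sub_smul_resolvent (hγ : LipschitzOnWith K γ (Icc 0 1))
    (hγa : MapsTo γ (Icc 0 1) (resolventSet ℂ a)) (hz : z ∈ resolventSet ℂ a)
    (hzγ : z ∉ γ '' Icc 0 1) :
    contourIntegral γ (fun w => (w - z)⁻¹ • resolvent a w) =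
      resolvent a z *
        ((2 * Real.pi * Complex.I * windingNumber γ z) • 1 - contourIntegral γ (resolvent a)) := by
  have hne : ∀ w ∈ γ '' Icc 0 1, w - z ≠ 0 := fun w hw h => hzγ (sub_eq_zero.1 h ▸ hw)
  have hinv : ContinuousOn (fun w => (w - z)⁻¹ • (1 : A)) (γ '' Icc 0 1) :=
    ((continuousOn_id.sub continuousOn_const).inv₀ hne).smul continuousOn_const
  have hres : ContinuousOn (resolvent a) (γ '' Icc 0 1) :=
    (continuousOn_resolvent a).mono hγa.image_subset
  have hident : EqOn (fun w => (w - z)⁻¹ • resolvent a w)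
      (fun w => ContinuousLinearMap.mul ℂ A (resolvent a z) ((w - z)⁻¹ • 1 - resolvent a w))
      (γ '' Icc 0 1) := fun w hw => by
    simp only [ContinuousLinearMap.mul_apply', mul_sub, mul_smul_comm, mul_one]
    rw [inv_smul_eq_iff₀ (hne w hw), smul_sub, smul_inv_smul₀ (hne w hw),
      ← resolvent_sub_resolvent_eq_smul hz (hγa.image_subset hw), sub_sub_cancel]
  rw [contourIntegral_congr hident,
    ← map_contourIntegral (f := fun w => (w - z)⁻¹ • 1 - resolvent a w) _
      (.of_continuousOn hγ (hinv.sub hres)),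
    contourIntegral_sub (.of_continuousOn hγ hinv) (.of_continuousOn hγ hres),
    contourIntegral_smul_const, contourIntegral_inv_sub, ContinuousLinearMap.mul_apply']

/-- By Liouville's theorem, since the extension is entire and vanishes at infinity. -/
theorem eq_zero_of_resolvent_mul_extends {Q : A} {C : ℂ → A}
    (hC : ∀ z ∈ spectrum ℂ a, DifferentiableAt ℂ C z)
    (h : ∀ z ∈ spectrum ℂ a, ∀ᶠ w in 𝓝 z, w ∈ resolventSet ℂ a → C w = resolvent a w * Q) :
    Q = 0 := by
  classical
  let E : ℂ → A := fun z => if z ∈ resolventSet ℂ a then resolvent a z * Q else C z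
  have hE : ∀ z ∈ resolventSet ℂ a, E z = resolvent a z * Q := fun z hz => if_pos hz
  have hdiff : Differentiable ℂ E := by
    intro z
    by_cases hz : z ∈ resolventSet ℂ a
    · refine ((spectrum.hasDerivAt_resolvent_const_left hz).differentiableAt.mul_const
        Q).congr_of_eventuallyEq ?_
      filter_upwards [(spectrum.isOpen_resolventSet a).mem_nhds hz] using hE
    · refine (hC z hz).congr_of_eventuallyEq ?_
      filter_upwards [h z hz] with w hw
      by_cases hwa : w ∈ resolventSet ℂ a
      · rw [hE w hwa, hw hwa]
      · exact if_neg hwa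
  have hlarge : ∀ᶠ z in Bornology.cobounded ℂ, z ∈ resolventSet ℂ a :=
    (spectrum.eventually_isUnit_resolvent a).mono fun z => spectrum.isUnit_resolvent.2
  have hlim : Tendsto E (cocompact ℂ) (𝓝 0) := by
    rw [← Metric.cobounded_eq_cocompact]
    have hQ := (spectrum.resolvent_tendsto_cobounded (𝕜 := ℂ) a).mul_const Q
    rw [zero_mul] at hQ
    exact hQ.congr' (hlarge.mono fun z hz => (hE z hz).symm)
  obtain ⟨z, hz⟩ := hlarge.exists
  have hQz : resolvent a z * Q = 0 := by
    rw [← hE z hz, hdiff.apply_eq_of_tendsto_cocompact z hlim]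
  exact (spectrum.isUnit_resolvent.1 hz).mul_right_eq_zero.1 hQz

variable {ι : Type*} [Fintype ι] {γ : ι → ℝ → ℂ}

theorem sum_contourIntegral_resolvent (hγ : WindsOnceAround (spectrum ℂ a) γ) :
    ∑ k, contourIntegral (γ k) (resolvent a) = (2 * Real.pi * Complex.I : ℂ) • 1 := by
  refine (sub_eq_zero.1 (eq_zero_of_resolvent_mul_extends (a := a)
    (C := fun z => ∑ k, contourIntegral (γ k) (fun w => (w - z)⁻¹ • resolvent a w))
    (fun z hz => ?_) fun z hz => ?_)).symm
  · refine DifferentiableAt.fun_sum fun k _ => ?_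
    obtain ⟨K, hK⟩ := hγ.lipschitz k
    exact (hasDerivAt_contourIntegral_inv_sub_smul hK ((continuousOn_resolvent a).mono
      (hγ.mapsTo_resolventSet k).image_subset) (hγ.notMem_image hz k)).differentiableAt
  · filter_upwards [hγ.eventually_winding hz, hγ.eventually_notMem_image hz] with w hw hwγ hwa
    have hterm := fun k => contourIntegral_inv_sub_smul_resolvent (hγ.lipschitz k).choose_spec
      (hγ.mapsTo_resolventSet k) hwa (hwγ k)
    simp only [hterm, ← Finset.mul_sum, Finset.sum_sub_distrib, ← Finset.sum_smul,
      hw, mul_one]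

theorem sum_contourIntegral_pow_smul_resolvent (hγ : WindsOnceAround (spectrum ℂ a) γ) (m : ℕ) :
    ∑ k, contourIntegral (γ k) (fun w => w ^ m • resolvent a w) =
      (2 * Real.pi * Complex.I : ℂ) • a ^ m := by
  have hterm := fun k => contourIntegral_pow_smul_resolvent (hγ.lipschitz k).choose_spec
    (hγ.closed k) (hγ.mapsTo_resolventSet k) m
  rw [Finset.sum_congr rfl fun k _ => hterm k, ← Finset.mul_sum, sum_contourIntegral_resolvent hγ,
    mul_smul_comm, mul_one]

theorem contourIntegrable_and_sum_contourIntegral_pow_smul_resolvent_apply {E : Type*}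
    [NormedAddCommGroup E] [NormedSpace ℂ E] [CompleteSpace E] {a : E →L[ℂ] E}
    (hγ : WindsOnceAround (spectrum ℂ a) γ) (x : E) (m : ℕ) :
    (∀ k, ContourIntegrable (γ k) fun w => w ^ m • resolvent a w x) ∧
    ∑ k, contourIntegral (γ k) (fun w => w ^ m • resolvent a w x) =
      (2 * Real.pi * Complex.I : ℂ) • (a ^ m) x := by
  let L := ContinuousLinearMap.apply ℂ E x
  have hint := fun k => contourIntegrable_pow_smul_resolvent (hγ.lipschitz k).choose_spec
    (hγ.mapsTo_resolventSet k) m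
  have hsum := congrArg L (sum_contourIntegral_pow_smul_resolvent hγ m)
  rw [map_sum] at hsum
  simp only [map_contourIntegral L (hint _)] at hsum
  exact ⟨fun k => (hint k).map L, hsum⟩

end Riesz

section RightComplexStructure

open ComplexConjugate

variable {B : Type*} [NormedRing B]

/-- Left multiplication as a representation of a normed ring by bounded operators, linear over
scalars that need only commute with it. -/
def mulLeftHom (𝕜 B : Type*) [NormedField 𝕜] [NormedRing B] [NormedSpace 𝕜 B]
    [SMulCommClass 𝕜 B B] : B →+* (B →L[𝕜] B) where
  toFun T := LinearMap.mkContinuous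
    { toFun := fun X => T * X, map_add' := mul_add T, map_smul' := fun c => mul_smul_comm c T }
    ‖T‖ (norm_mul_le T)
  map_one' := ContinuousLinearMap.ext one_mul
  map_mul' S T := ContinuousLinearMap.ext (mul_assoc S T)
  map_zero' := ContinuousLinearMap.ext zero_mul
  map_add' S T := ContinuousLinearMap.ext (add_mul S T)

@[simp]
theorem mulLeftHom_apply {𝕜 : Type*} [NormedField 𝕜] [NormedSpace 𝕜 B] [SMulCommClass 𝕜 B B]
    (T X : B) : mulLeftHom 𝕜 B T X = T * X := rfl

variable [NormedAlgebra ℝ B]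

/-- The value at `T` of the real polynomial `(X - z) (X - conj z)`. -/
def conjPairPoly (z : ℂ) (T : B) : B := T ^ 2 - (2 * z.re) • T + (‖z‖ ^ 2) • 1

section

variable [NormedSpace ℂ B] [IsScalarTower ℝ ℂ B] [SMulCommClass ℂ B B] {T : B} {z : ℂ}

theorem algebraMap_conj_sub_mul_algebraMap_sub (T : B) (z : ℂ) :
    (algebraMap ℂ (B →L[ℂ] B) (conj z) - mulLeftHom ℂ B T) *
      (algebraMap ℂ (B →L[ℂ] B) z - mulLeftHom ℂ B T) = mulLeftHom ℂ B (conjPairPoly z T) := by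
  have hadd (X : B) : conj z • X + z • X = (2 * z.re) • X := by
    rw [← add_smul, add_comm, Complex.add_conj, ← smul_one_smul ℂ (2 * z.re) X, Complex.real_smul,
      mul_one]
  have hmul (X : B) : (conj z * z) • X = (‖z‖ ^ 2) • X := by
    rw [Complex.conj_mul', ← Complex.ofReal_pow, ← smul_one_smul ℂ (‖z‖ ^ 2) X, Complex.real_smul,
      mul_one]
  ext X
  calc conj z • (z • X - T * X) - T * (z • X - T * X)
      = T * (T * X) - (conj z • (T * X) + z • (T * X)) + (conj z * z) • X := by
        rw [smul_sub, mul_sub, mul_smul_comm, mul_smul]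
        abel
    _ = conjPairPoly z T * X := by
        rw [hadd, hmul, conjPairPoly, add_mul, sub_mul, smul_mul_assoc, smul_mul_assoc, one_mul,
          pow_two T, mul_assoc]

theorem mem_resolventSet_mulLeftHom (hz : IsUnit (conjPairPoly z T)) :
    z ∈ resolventSet ℂ (mulLeftHom ℂ B T) := by
  have h := hz.map (mulLeftHom ℂ B)
  rw [← algebraMap_conj_sub_mul_algebraMap_sub] at h
  refine ((Commute.isUnit_mul_iff ?_).1 h).2
  exact (Algebra.commute_algebraMap_left _ _).sub_left
    ((Algebra.commute_algebraMap_right _ _).sub_right (Commute.refl _))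

theorem resolvent_mulLeftHom_apply_one (hz : IsUnit (conjPairPoly z T)) :
    resolvent (mulLeftHom ℂ B T) z 1 =
      -(Ring.inverse (conjPairPoly z T) * (T - conj z • 1)) := by
  have hleft : mulLeftHom ℂ B (Ring.inverse (conjPairPoly z T)) *
      (algebraMap ℂ (B →L[ℂ] B) (conj z) - mulLeftHom ℂ B T) *
        (algebraMap ℂ (B →L[ℂ] B) z - mulLeftHom ℂ B T) = 1 := by
    rw [mul_assoc, algebraMap_conj_sub_mul_algebraMap_sub, ← map_mul, Ring.inverse_mul_cancel _ hz,
      map_one]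
  have hright := Ring.mul_inverse_cancel _ (mem_resolventSet_mulLeftHom hz)
  rw [resolvent, ← left_inv_eq_right_inv hleft hright, ← mul_neg, neg_sub]
  change Ring.inverse (conjPairPoly z T) * (conj z • 1 - T * 1) = _
  rw [mul_one]

variable [CompleteSpace B] {ι : Type*} [Fintype ι] {γ : ι → ℝ → ℂ}

theorem contourIntegrable_and_sum_contourIntegral_conjPairPoly
    (hγ : WindsOnceAround {z | ¬ IsUnit (conjPairPoly z T)} γ) (m : ℕ) :
    (∀ k, ContourIntegrable (γ k) fun z =>
      z ^ m • -(Ring.inverse (conjPairPoly z T) * (T - conj z • 1))) ∧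
    ∑ k, contourIntegral (γ k)
      (fun z => z ^ m • -(Ring.inverse (conjPairPoly z T) * (T - conj z • 1))) =
      (2 * Real.pi * Complex.I : ℂ) • T ^ m := by
  have hspec : WindsOnceAround (spectrum ℂ (mulLeftHom ℂ B T)) γ :=
    hγ.mono fun z hz h => hz (mem_resolventSet_mulLeftHom h)
  have hres (k : ι) : EqOn (fun z => z ^ m • resolvent (mulLeftHom ℂ B T) z 1)
      (fun z => z ^ m • -(Ring.inverse (conjPairPoly z T) * (T - conj z • 1)))
      (γ k '' Icc 0 1) := forall_mem_image.2 fun t ht => by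
    simp only [resolvent_mulLeftHom_apply_one (not_not.1 (hγ.mapsTo_compl k ht))]
  obtain ⟨hint, hsum⟩ :=
    contourIntegrable_and_sum_contourIntegral_pow_smul_resolvent_apply hspec 1 m
  rw [← map_pow, mulLeftHom_apply, mul_one] at hsum
  exact ⟨fun k => (hint k).congr (hres k),
    (Finset.sum_congr rfl fun k _ => contourIntegral_congr (hres k)).symm.trans hsum⟩

end

/-- The complex structure of a real normed algebra in which `z` acts as right multiplication by
`j z`. -/
abbrev rightMulNormedSpace (j : ℂ →ₐ[ℝ] B) (hj : ∀ z, ‖j z‖ ≤ ‖z‖) : NormedSpace ℂ B where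
  smul z X := X * j z
  one_smul X := show X * j 1 = X by rw [map_one, mul_one]
  mul_smul z w X := show X * j (z * w) = X * j w * j z by rw [mul_comm z, map_mul, mul_assoc]
  smul_zero z := zero_mul (j z)
  smul_add z X Y := add_mul X Y (j z)
  add_smul z w X := show X * j (z + w) = X * j z + X * j w by rw [map_add, mul_add]
  zero_smul X := show X * j 0 = 0 by rw [map_zero, mul_zero]
  norm_smul_le z X := (norm_mul_le X (j z)).trans <| by
    rw [mul_comm]
    gcongr
    exact hj z

variable [CompleteSpace B] {ι : Type*} [Fintype ι] {γ : ι → ℝ → ℂ} {T : B}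

theorem intervalIntegrable_and_sum_integral_conjPairPoly {j : ℂ →ₐ[ℝ] B} (hj : ∀ z, ‖j z‖ ≤ ‖z‖)
    (hγ : WindsOnceAround {z | ¬ IsUnit (conjPairPoly z T)} γ) (m : ℕ) (b : B) :
    (∀ k, IntervalIntegrable (fun t => -(Ring.inverse (conjPairPoly (γ k t) T) *
      (T - j (conj (γ k t)))) * (j (deriv (γ k) t * γ k t ^ m) * b)) volume 0 1) ∧
    ∑ k, ∫ t in (0 : ℝ)..1, -(Ring.inverse (conjPairPoly (γ k t) T) *
      (T - j (conj (γ k t)))) * (j (deriv (γ k) t * γ k t ^ m) * b) =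
      T ^ m * (j (2 * Real.pi * Complex.I) * b) := by
  -- keeps the integrals over the given real structure, not the one restricted from `ℂ`
  let : NormedSpace ℝ B := NormedAlgebra.toNormedSpace B
  let := rightMulNormedSpace j hj
  have : SMulCommClass ℂ B B := ⟨fun z T X => mul_assoc T X (j z)⟩
  have : IsScalarTower ℝ ℂ B := ⟨fun r z X =>
    (congrArg (X * ·) (map_smul j r z)).trans (mul_smul_comm r X (j z))⟩
  obtain ⟨hint, hsum⟩ := contourIntegrable_and_sum_contourIntegral_conjPairPoly (T := T) hγ m
  have hintegrand (k : ι) (t : ℝ) : -(Ring.inverse (conjPairPoly (γ k t) T) *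
      (T - j (conj (γ k t)))) * (j (deriv (γ k) t * γ k t ^ m) * b) =
      AddMonoidHom.mulRight b (deriv (γ k) t • γ k t ^ m •
        -(Ring.inverse (conjPairPoly (γ k t) T) * (T - conj (γ k t) • 1))) := by
    change _ = -(Ring.inverse (conjPairPoly (γ k t) T) * (T - 1 * j (conj (γ k t)))) *
      j (γ k t ^ m) * j (deriv (γ k) t) * b
    rw [one_mul, mul_comm (deriv (γ k) t), map_mul, mul_assoc _ (j _) (j _), mul_assoc _ (_ * _) b]
  have hcont : Continuous (AddMonoidHom.mulRight b) := continuous_mul_const b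
  simp only [hintegrand]
  refine ⟨fun k => (hint k).map_addMonoidHom hcont, ?_⟩
  rw [← Finset.sum_congr rfl fun k _ => map_contourIntegral_addMonoidHom hcont (hint k), ← map_sum,
    hsum]
  exact mul_assoc _ _ b

end RightComplexStructure

section Slice

open ComplexConjugate

variable {I : ℍ[ℝ]}

theorem star_eq_neg_of_mem_unitSphere (hI : I ∈ unitSphere) : star I = -I := by
  ext <;> simp [hI.1]

theorem mul_self_of_mem_unitSphere (hI : I ∈ unitSphere) : I * I = -1 := by
  rw [← neg_eq_iff_eq_neg, ← mul_neg, ← star_eq_neg_of_mem_unitSphere hI, Quaternion.self_mul_star,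
    Quaternion.normSq_eq_norm_mul_self, hI.2, mul_one, Quaternion.coe_one]

/-- `slice I` as an embedding of the algebra of complex numbers into the quaternions. -/
def sliceHom (hI : I ∈ unitSphere) : ℂ →ₐ[ℝ] ℍ[ℝ] :=
  Complex.liftAux I (mul_self_of_mem_unitSphere hI)

theorem sliceHom_apply (hI : I ∈ unitSphere) (z : ℂ) : sliceHom hI z = slice I z := by
  rw [sliceHom, Complex.liftAux_apply, slice, Quaternion.mul_coe_eq_smul]
  rfl

theorem sliceHom_I (hI : I ∈ unitSphere) : sliceHom hI Complex.I = I :=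
  Complex.liftAux_apply_I _ _

theorem slice_re (hI : I ∈ unitSphere) (z : ℂ) : (slice I z).re = z.re := by
  simp [slice, hI.1]

theorem star_slice (hI : I ∈ unitSphere) (z : ℂ) : star (slice I z) = slice I (conj z) := by
  simp [slice, star_eq_neg_of_mem_unitSphere hI, Quaternion.coe_commutes]

theorem norm_slice (hI : I ∈ unitSphere) (z : ℂ) : ‖slice I z‖ = ‖z‖ := by
  have h : ((‖slice I z‖ ^ 2 : ℝ) : ℍ[ℝ]) = (‖z‖ ^ 2 : ℝ) := by
    rw [sq, ← Quaternion.normSq_eq_norm_mul_self, ← Quaternion.self_mul_star, star_slice hI,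
      ← sliceHom_apply hI, ← sliceHom_apply hI, ← map_mul, Complex.mul_conj',
      ← Complex.ofReal_pow]
    exact (sliceHom hI).commutes _
  exact (pow_left_inj₀ (norm_nonneg _) (norm_nonneg _) two_ne_zero).1 (Quaternion.coe_injective h)

theorem neg_mul_slice_mul_pow_mul (hI : I ∈ unitSphere) (w z : ℂ) (m : ℕ) (a : ℍ[ℝ]) :
    -I * slice I w * (slice I z ^ m * a) = slice I (w * z ^ m) * (-I * a) := by
  have h : -I * sliceHom hI (w * z ^ m) = sliceHom hI (w * z ^ m) * -I := by
    simpa only [map_mul, map_neg, sliceHom_I] using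
      congrArg (sliceHom hI) (mul_comm (-Complex.I) (w * z ^ m))
  simp only [← sliceHom_apply hI]
  rw [← mul_assoc _ (-I), ← h, map_mul, map_pow]
  simp only [mul_assoc]

theorem slice_two_pi_I_mul (hI : I ∈ unitSphere) (a : ℍ[ℝ]) :
    slice I (2 * Real.pi * Complex.I) * (-I * a) = (2 * Real.pi) • a := by
  have h : (2 * Real.pi * Complex.I : ℂ) = (2 * Real.pi) • Complex.I := by
    rw [Complex.real_smul, Complex.ofReal_mul, Complex.ofReal_ofNat]
  rw [h, ← sliceHom_apply hI, map_smul, sliceHom_I, ← mul_assoc, smul_mul_assoc, mul_neg,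
    mul_self_of_mem_unitSphere hI, neg_neg, smul_mul_assoc, one_mul]

end Slice

section Operators

open ComplexConjugate

variable {V : Type*} [NormedAddCommGroup V] [NormedSpace ℝ V]
  [Module ℍ[ℝ]ᵐᵒᵖ V] [IsScalarTower ℝ ℍ[ℝ]ᵐᵒᵖ V]

/-- `B(V)` as a normed ring under composition, extending the operator norm. -/
abbrev operatorNormedRing : NormedRing (V →L[ℍ[ℝ]ᵐᵒᵖ] V) where
  __ := instNormedAddCommGroupB
  __ := ContinuousLinearMap.ring
  norm_mul_le S T := (S.restrictScalars ℝ).opNorm_comp_le (T.restrictScalars ℝ)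

attribute [local instance] operatorNormedRing

/-- `B(V)` as a real normed algebra, with the scalar action given on `B(V)`. -/
abbrev operatorNormedAlgebra : NormedAlgebra ℝ (V →L[ℍ[ℝ]ᵐᵒᵖ] V) where
  __ := Algebra.ofModule smul_mul_assoc mul_smul_comm
  norm_smul_le := norm_smul_le

attribute [local instance] operatorNormedAlgebra

variable {I : ℍ[ℝ]}

theorem sPoly_slice (hI : I ∈ unitSphere) (z : ℂ) (T : V →L[ℍ[ℝ]ᵐᵒᵖ] V) :
    sPoly (slice I z) T = conjPairPoly z T := by
  rw [sPoly, slice_re hI, norm_slice hI]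
  rfl

variable [Module ℍ[ℝ] V] [SMulCommClass ℍ[ℝ]ᵐᵒᵖ ℍ[ℝ] V] [IsBoundedSMul ℍ[ℝ] V]

theorem norm_leftMul_le (a : ℍ[ℝ]) : ‖(leftMul a : V →L[ℍ[ℝ]ᵐᵒᵖ] V)‖ ≤ ‖a‖ :=
  ((leftMul a : V →L[ℍ[ℝ]ᵐᵒᵖ] V).restrictScalars ℝ).opNorm_le_bound (norm_nonneg a)
    fun v => norm_smul_le a v

variable [IsScalarTower ℝ ℍ[ℝ] V]

variable (V) in
/-- `leftMul` as a representation of the algebra of quaternions. -/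
def leftMulHom : ℍ[ℝ] →ₐ[ℝ] (V →L[ℍ[ℝ]ᵐᵒᵖ] V) where
  toFun := leftMul
  map_one' := one_smul _ _
  map_mul' a b := ContinuousLinearMap.ext fun v => mul_smul a b v
  map_zero' := zero_smul _ _
  map_add' a b := add_smul a b _
  commutes' r := ContinuousLinearMap.ext fun v => algebraMap_smul ℍ[ℝ] r v

theorem leftMulHom_apply (a : ℍ[ℝ]) : leftMulHom V a = leftMul a := rfl

theorem sIntegrand_pow_mul (hI : I ∈ unitSphere) (T : V →L[ℍ[ℝ]ᵐᵒᵖ] V) (m : ℕ)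
    (a : ℍ[ℝ]) (γ : ℝ → ℂ) :
    sIntegrand I T (fun s => s ^ m * a) γ = fun t =>
      -(Ring.inverse (conjPairPoly (γ t) T) * (T - leftMul (slice I (conj (γ t))))) *
        (leftMul (slice I (deriv γ t * γ t ^ m)) * leftMul (-I * a)) := by
  ext1 t
  rw [sIntegrand, neg_mul_slice_mul_pow_mul hI, sResolvent, sPoly_slice hI, star_slice hI]
  exact congrArg _ (map_mul (leftMulHom V) _ _)

theorem sIntegrand_sum {ι : Type*} (s : Finset ι) (I : ℍ[ℝ]) (T : V →L[ℍ[ℝ]ᵐᵒᵖ] V)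
    (f : ι → ℍ[ℝ] → ℍ[ℝ]) (γ : ℝ → ℂ) :
    sIntegrand I T (fun q => ∑ i ∈ s, f i q) γ = ∑ i ∈ s, sIntegrand I T (f i) γ := by
  ext1 t
  simp only [sIntegrand, ← leftMulHom_apply, Finset.sum_apply, Finset.mul_sum, map_sum]

theorem sIntegral_sum {ι : Type*} {s : Finset ι} {T : V →L[ℍ[ℝ]ᵐᵒᵖ] V}
    {f : ι → ℍ[ℝ] → ℍ[ℝ]} {n : ℕ} {γ : Fin n → ℝ → ℂ}
    (h : ∀ i ∈ s, ∀ k, IntervalIntegrable (sIntegrand I T (f i) (γ k)) volume 0 1) :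
    sIntegral I T (fun q => ∑ i ∈ s, f i q) γ = ∑ i ∈ s, sIntegral I T (f i) γ := by
  simp only [sIntegral, sIntegrand_sum, Finset.sum_apply]
  rw [Finset.sum_comm]
  exact Finset.sum_congr rfl fun k _ =>
    intervalIntegral.integral_finsetSum fun i hi => h i hi k

theorem intervalIntegrable_and_sIntegral_pow_mul [CompleteSpace V] [IsBoundedSMul ℍ[ℝ]ᵐᵒᵖ V]
    {T : V →L[ℍ[ℝ]ᵐᵒᵖ] V} (hI : I ∈ unitSphere) {n : ℕ} {γ : Fin n → ℝ → ℂ}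
    (hγ : WindsOnceAround (slice I ⁻¹' sSpectrum T) γ) (m : ℕ) (a : ℍ[ℝ]) :
    (∀ k, IntervalIntegrable (sIntegrand I T (fun s => s ^ m * a) (γ k)) volume 0 1) ∧
    sIntegral I T (fun s => s ^ m * a) γ = (2 * Real.pi) • (T ^ m * leftMul a) := by
  have hnorm (z : ℂ) : ‖(leftMulHom V).comp (sliceHom hI) z‖ ≤ ‖z‖ := by
    rw [AlgHom.comp_apply, sliceHom_apply, leftMulHom_apply, ← norm_slice hI]
    exact norm_leftMul_le _
  have hγ' : WindsOnceAround {z | ¬ IsUnit (conjPairPoly z T)} γ :=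
    hγ.mono fun z hz => by rwa [mem_preimage, sSpectrum, mem_ofPred_eq, sPoly_slice hI]
  have h := intervalIntegrable_and_sum_integral_conjPairPoly hnorm hγ' m (leftMul (-I * a))
  simp only [AlgHom.comp_apply, sliceHom_apply, leftMulHom_apply, ← sIntegrand_pow_mul hI] at h
  refine ⟨h.1, ?_⟩
  rw [← mul_smul_comm, ← leftMulHom_apply, ← map_smul, ← slice_two_pi_I_mul hI, map_mul]
  exact h.2

end Operators

end QuatFC

end

theorem mainTheorem4_general {V : Type*} [NormedAddCommGroup V] [NormedSpace ℝ V] [CompleteSpace V]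
    [Module ℍ[ℝ] V] [Module ℍ[ℝ]ᵐᵒᵖ V] [SMulCommClass ℍ[ℝ]ᵐᵒᵖ ℍ[ℝ] V]
    [IsScalarTower ℝ ℍ[ℝ] V] [IsScalarTower ℝ ℍ[ℝ]ᵐᵒᵖ V]
    [IsBoundedSMul ℍ[ℝ] V] [IsBoundedSMul ℍ[ℝ]ᵐᵒᵖ V]
    (T : V →L[ℍ[ℝ]ᵐᵒᵖ] V) {I : ℍ[ℝ]} (hI : I ∈ QuatFC.unitSphere)
    {n : ℕ} {γ : Fin n → ℝ → ℂ}
    (hγ : QuatFC.WindsOnceAround (QuatFC.slice I ⁻¹' QuatFC.sSpectrum T) γ) :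
    (∀ (m : ℕ) (a : ℍ[ℝ]),
      (∀ k, IntervalIntegrable (QuatFC.sIntegrand I T (fun s => s ^ m * a) (γ k))
        MeasureTheory.volume 0 1) ∧
      T ^ m * QuatFC.leftMul a =
        (1 / (2 * Real.pi)) • QuatFC.sIntegral I T (fun s => s ^ m * a) γ) ∧
    (∀ (N : ℕ) (a : ℕ → ℍ[ℝ]),
      (∀ k, IntervalIntegrable
        (QuatFC.sIntegrand I T (fun s => ∑ m ∈ Finset.range (N + 1), s ^ m * a m) (γ k))
        MeasureTheory.volume 0 1) ∧
      ∑ m ∈ Finset.range (N + 1), T ^ m * QuatFC.leftMul (a m) =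
        (1 / (2 * Real.pi)) •
          QuatFC.sIntegral I T (fun s => ∑ m ∈ Finset.range (N + 1), s ^ m * a m) γ) := by
  have hmono := QuatFC.intervalIntegrable_and_sIntegral_pow_mul hI hγ
  have hpow (m : ℕ) (a : ℍ[ℝ]) : T ^ m * QuatFC.leftMul a =
      (1 / (2 * Real.pi)) • QuatFC.sIntegral I T (fun s => s ^ m * a) γ := by
    rw [(hmono m a).2, one_div, inv_smul_smul₀ Real.two_pi_pos.ne']
  refine ⟨fun m a => ⟨(hmono m a).1, hpow m a⟩, fun N a => ⟨fun k => ?_, ?_⟩⟩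
  · rw [QuatFC.sIntegrand_sum]
    exact .sum _ fun m _ => (hmono m (a m)).1 k
  · rw [QuatFC.sIntegral_sum fun m _ => (hmono m (a m)).1, Finset.smul_sum]
    exact Finset.sum_congr rfl fun m _ => hpow m (a m)

theorem mainTheorem4 {V : Type*} [NormedAddCommGroup V] [NormedSpace ℝ V] [CompleteSpace V]
    [Module ℍ[ℝ] V] [Module ℍ[ℝ]ᵐᵒᵖ V] [SMulCommClass ℍ[ℝ]ᵐᵒᵖ ℍ[ℝ] V]
    [IsScalarTower ℝ ℍ[ℝ] V] [IsScalarTower ℝ ℍ[ℝ]ᵐᵒᵖ V]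
    [IsBoundedSMul ℍ[ℝ] V] [IsBoundedSMul ℍ[ℝ]ᵐᵒᵖ V]
    (T : V →L[ℍ[ℝ]ᵐᵒᵖ] V) (I : ℍ[ℝ]) (hI : I ∈ QuatFC.unitSphere)
    (U : Set ℍ[ℝ]) (hUL : U ⊆ QuatFC.slicePlane I)
    (hUopen : IsOpen (QuatFC.slice I ⁻¹' U)) (hUbdd : Bornology.IsBounded U)
    (hU : QuatFC.slicePlane I ∩ QuatFC.sSpectrum T ⊆ U)
    {n : ℕ} (γ : Fin n → ℝ → ℂ)
    (hγ : QuatFC.IsPositiveBoundary (QuatFC.slice I ⁻¹' U) γ) :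
    (∀ (m : ℕ) (a : ℍ[ℝ]),
      (∀ k, IntervalIntegrable (QuatFC.sIntegrand I T (fun s => s ^ m * a) (γ k))
        MeasureTheory.volume 0 1) ∧
      T ^ m * QuatFC.leftMul a =
        (1 / (2 * Real.pi)) • QuatFC.sIntegral I T (fun s => s ^ m * a) γ) ∧
    (∀ (N : ℕ) (a : ℕ → ℍ[ℝ]),
      (∀ k, IntervalIntegrable
        (QuatFC.sIntegrand I T (fun s => ∑ m ∈ Finset.range (N + 1), s ^ m * a m) (γ k))
        MeasureTheory.volume 0 1) ∧
      ∑ m ∈ Finset.range (N + 1), T ^ m * QuatFC.leftMul (a m) =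
        (1 / (2 * Real.pi)) •
          QuatFC.sIntegral I T (fun s => ∑ m ∈ Finset.range (N + 1), s ^ m * a m) γ) :=
  mainTheorem4_general T hI (hγ.windsOnceAround hUopen fun z hz => hU ⟨Set.mem_range_self z, hz⟩)
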